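/- Let $0<\lambda_1<1<\lambda_2$ with $\lambda_1\lambda_2<1$, and let $d_1,d_2\in\mathbb R$ be such that the maps $x\mapsto\lambda_1x+d_1$ and $x\mapsto\lambda_2x+d_2$ have no common fixed point. For $\varepsilon\in\mathbb R$ with $\lambda_1+\varepsilon>0$ and $(\lambda_1+\varepsilon)\lambda_2<1$, let $\mu_{\lambda_1+\varepsilon,\lambda_2}$ be the stationary measure of the iterated function system $f_1(x)=(\lambda_1+\varepsilon)x+d_1$, $f_2(x)=\lambda_2x+d_2$ with probabilities $(\frac12,\frac12)$, that is, the unique Borel probability measure $\mu$ on $\mathbb R$ with $\mu=\frac12(f_1)_*\mu+\frac12(f_2)_*\mu$ (it exists and is unique). Let $\nu=(\frac12,\frac12)^{\mathbb N}$ be the Bernoulli measure on $\Sigma=\{1,2\}^{\mathbb N}$. With $\lambda_1(\varepsilon)=\lambda_1+\varepsilon$ and $\lambda_2(\varepsilon)=\lambda_2$, put $$X(\varepsilon)(i_1,i_2,\dots)=\sum_{m=0}^{\infty}\lambda_{i_1}(\varepsilon)\cdots\lambda_{i_m}(\varepsilon)\,d_{i_{m+1}},\qquad X=X(0),\qquad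 X^{(j)}=\frac{d^j}{d\varepsilon^j}X(\varepsilon)\Big|_{\varepsilon=0}\quad(j\ge1).$$ For $\nu$-almost every word the series $X(\varepsilon)$ converges for all such $\varepsilon$, $\varepsilon\mapsto X(\varepsilon)$ is infinitely differentiable at $0$, and, for all $j\ge1$, $$X^{(j)}=\frac{j!}{\lambda_1^j}\sum_{m=0}^{\infty}\lambda_{i_1}\cdots\lambda_{i_m}\binom{o(m)}{j}\,d_{i_{m+1}},$$ where $o(m)$ is the number of $1$'s among $i_1,\dots,i_m$. Let $\varphi\in C_c^\infty(\mathbb R)$ be real-valued. Then $h(\varepsilon)=\int_{\mathbb R}\varphi\,d\mu_{\lambda_1+\varepsilon,\lambda_2}$ is infinitely differentiable at $0$ (that is, for every $n$ it is $C^n$ in a neighbourhood of $0$), and for every integer $l\ge0$ $$h^{(l)}(0)=\int_\Sigma\frac{d^l}{d\varepsilon^l}\,\varphi(X(\varepsilon))\Big|_{\varepsilon=0}\,d\nu=\int_\Sigma\ \sum_{k_1+2k_2+\cdots+lk_l=l}L(k_1,\dots,k_l)\,\varphi^{(k)}(X)\prod_{j=1}^{l}\bigl(X^{(j)}\bigr)^{k_j}\,d\nu,$$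 where both integrands are $\nu$-integrable, the sum is over all tuples of non-negative integers $(k_1,\dots,k_l)$ with $k_1+2k_2+\cdots+lk_l=l$, $k=k_1+\cdots+k_l$, and $$L(k_1,\dots,k_l)=\frac{l!}{k_1!\,(1!)^{k_1}\cdots k_l!\,(l!)^{k_l}}.$$ -/

import Mathlib

open MeasureTheory Finset
open scoped ContDiff ENNReal

namespace LinearResponse

noncomputable section

/-- The symbolic space of one-sided infinite words; the letters `1, 2` are the elements `0, 1` of
`Fin 2`, and the `m`-th letter of a word `w` (`m = 1, 2, …`) is `w (m - 1)`. -/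
abbrev Words : Type := ℕ → Fin 2

/-- The Bernoulli measure `(1/2, 1/2)^ℕ` on words. -/
def wordMeasure : Measure Words :=
  Measure.infinitePi fun _ : ℕ => (PMF.uniformOfFintype (Fin 2)).toMeasure

/-- `μ` is a stationary measure of the probabilistic iterated function system consisting of
`x ↦ lam i * x + d i`, `i = 0, 1`, each chosen with probability `1/2`. -/
def IsStationary (lam d : Fin 2 → ℝ) (μ : Measure ℝ) : Prop :=
  IsProbabilityMeasure μ ∧
    μ = ∑ i : Fin 2, (2⁻¹ : ℝ≥0∞) • μ.map (fun x => lam i * x + d i)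

open Classical in
/-- The stationary measure of the system (and the zero measure if there is none). -/
def stationaryMeasure (lam d : Fin 2 → ℝ) : Measure ℝ :=
  if h : ∃ μ, IsStationary lam d μ then h.choose else 0

/-- The contraction ratios `lam₁ + ε, lam₂` of the perturbed system. -/
def ratio (lam₁ lam₂ ε : ℝ) : Fin 2 → ℝ := ![lam₁ + ε, lam₂]

/-- The product of the ratios of the first `m` letters of `w`. -/
def wordRatio (lam : Fin 2 → ℝ) (w : Words) (m : ℕ) : ℝ := ∏ k ∈ range m, lam (w k)

/-- The symbolic projection: the sum over `m ≥ 0` of the product of the ratios of the first `m`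
letters, times the translation of the letter number `m + 1`. -/
def proj (lam d : Fin 2 → ℝ) (w : Words) : ℝ := ∑' m : ℕ, wordRatio lam w m * d (w m)

/-- The random variable `X(ε)`. -/
def X (lam₁ lam₂ : ℝ) (d : Fin 2 → ℝ) (ε : ℝ) (w : Words) : ℝ :=
  proj (ratio lam₁ lam₂ ε) d w

/-- `X^{(j)}`, the `j`-th derivative of `ε ↦ X(ε)` at `0`. -/
def XDeriv (lam₁ lam₂ : ℝ) (d : Fin 2 → ℝ) (j : ℕ) (w : Words) : ℝ :=
  iteratedDeriv j (fun ε => X lam₁ lam₂ d ε w) 0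

/-- The number of letters `1` (that is, `0 : Fin 2`) among the first `m` letters of `w`. -/
def onesCount (w : Words) (m : ℕ) : ℕ := #{k ∈ range m | w k = 0}

/-- The tuples `(k₁, …, k_l)` of natural numbers with `k₁ + 2 k₂ + ⋯ + l k_l = l`; the entry `k_j`
is the value at `j - 1`. (Every entry of such a tuple is at most `l`.) -/
def faaIndex (l : ℕ) : Finset (Fin l → ℕ) :=
  {k ∈ Fintype.piFinset fun _ : Fin l => range (l + 1) | ∑ j : Fin l, ((j : ℕ) + 1) * k j = l}

/-- The coefficient `l! / ∏_j k_j! (j!)^{k_j}`. -/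
def faaCoeff (l : ℕ) (k : Fin l → ℕ) : ℝ :=
  (l.factorial : ℝ) / ∏ j : Fin l, ((k j).factorial : ℝ) * (((j : ℕ) + 1).factorial : ℝ) ^ k j

/-- The formal derivative of order `l` of `φ(X(ε))` at `ε = 0`, by Faà di Bruno's formula. -/
def formalDeriv (lam₁ lam₂ : ℝ) (d : Fin 2 → ℝ) (φ : ℝ → ℝ) (l : ℕ) (w : Words) : ℝ :=
  ∑ k ∈ faaIndex l, faaCoeff l k * iteratedDeriv (∑ j, k j) φ (X lam₁ lam₂ d 0 w) *
    ∏ j : Fin l, XDeriv lam₁ lam₂ d ((j : ℕ) + 1) w ^ k j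

/-- `h(ε) = ∫ φ dμ_{lam₁ + ε, lam₂}`. -/
def response (lam₁ lam₂ : ℝ) (d : Fin 2 → ℝ) (φ : ℝ → ℝ) (ε : ℝ) : ℝ :=
  ∫ x, φ x ∂(stationaryMeasure (ratio lam₁ lam₂ ε) d)

end

end LinearResponse

/-!
For almost every word the products `λ_{i₁} ⋯ λ_{i_m}` decay exponentially, so that the iteration of
the random maps converges to `X(ε)`; hence `X(ε)` has the stationary measure as its distribution,
and `h(ε) = ∫ φ(X(ε)) dν`. Along such a word `X(ε)` is a convergent power series in `λ₁ + ε`.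

The point is to differentiate under the integral sign. The `n`-th derivative of `φ(X(ε))` is at most
a constant times `B ^ n` when the products are at most `B q ^ m`, but the products are only known to
have geometrically decaying moments of one small order `s`, so that `B ^ n` need not be integrable.
The remedy is that the derivative vanishes unless `X(ε)` lies in the support of `φ`. If `p` is the
fixed point of the expanding map, then `p - X(ε)` is a series with terms of constant sign, in which
the products occur with the coefficient `p - f₁(p) ≠ 0`. So where `X(ε)` is bounded, the
products are bounded by a constant. Interpolating between this bound and the bound for the `s`-th
powers makes `B ^ n` integrable for every `n`.
-/

namespace LinearResponse

noncomputable section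

/-! ### Faà di Bruno's formula -/

section FaaDiBruno

variable {𝕜 : Type*} [NontriviallyNormedField 𝕜]

/-- The Taylor series of `f` at `x`, as a formal power series in the increment. -/
def taylorSeries (f : 𝕜 → 𝕜) (x : 𝕜) : PowerSeries 𝕜 :=
  PowerSeries.mk fun n => iteratedDeriv n f x / n.factorial

theorem coeff_taylorSeries (f : 𝕜 → 𝕜) (x : 𝕜) (n : ℕ) :
    (taylorSeries f x).coeff n = iteratedDeriv n f x / n.factorial :=
  PowerSeries.coeff_mk _ _

theorem coeff_zero_taylorSeries (f : 𝕜 → 𝕜) (x : 𝕜) : (taylorSeries f x).coeff 0 = f x := by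
  simp [coeff_taylorSeries]

theorem iteratedDeriv_comp_congr {g₁ g₂ f : 𝕜 → 𝕜} {x : 𝕜} {n : ℕ}
    (h₁ : ContDiffAt 𝕜 n g₁ (f x)) (h₂ : ContDiffAt 𝕜 n g₂ (f x)) (hf : ContDiffAt 𝕜 n f x)
    (h : ∀ i ≤ n, iteratedDeriv i g₁ (f x) = iteratedDeriv i g₂ (f x)) :
    iteratedDeriv n (g₁ ∘ f) x = iteratedDeriv n (g₂ ∘ f) x := by
  rw [iteratedDeriv_comp_eq_sum_orderedFinpartition h₁ hf le_rfl,
    iteratedDeriv_comp_eq_sum_orderedFinpartition h₂ hf le_rfl]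
  exact sum_congr rfl fun c _ => by rw [h _ c.length_le]

theorem coeff_pow_eq_sum_piAntidiag {R : Type*} [CommRing R] {U : PowerSeries R}
    (hU : U.coeff 0 = 0) (l k : ℕ) :
    (U ^ k).coeff l =
      ∑ κ ∈ piAntidiag (univ : Finset (Fin l)) k with ∑ j : Fin l, ((j : ℕ) + 1) * κ j = l,
        (Nat.multinomial univ κ : R) * ∏ j : Fin l, U.coeff ((j : ℕ) + 1) ^ κ j := by
  -- Only the coefficients of index at most `l` matter, so that `U` may be replaced by a sum of `l`
  -- monomials, to which the multinomial theorem applies.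
  let A : PowerSeries R := ∑ j : Fin l, PowerSeries.monomial (j + 1) (U.coeff (j + 1))
  have coeff_A : ∀ m < l + 1, A.coeff m = U.coeff m := by
    rintro (_ | m) hm
    · simp [A, map_sum, PowerSeries.coeff_monomial, hU]
    · simp only [A, map_sum, PowerSeries.coeff_monomial, Nat.add_right_cancel_iff]
      rw [Fintype.sum_eq_single ⟨m, by lia⟩ fun j hj => if_neg fun h => hj (Fin.ext h.symm)]
      simp
  have dvd_sub : (PowerSeries.X : PowerSeries R) ^ (l + 1) ∣ U - A :=
    PowerSeries.X_pow_dvd_iff.mpr fun m hm => by rw [map_sub, coeff_A m hm, sub_self]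
  have coeff_pow : (U ^ k).coeff l = (A ^ k).coeff l := by
    have h := PowerSeries.X_pow_dvd_iff.mp (dvd_sub.trans (sub_dvd_pow_sub_pow U A k)) l (by lia)
    rwa [map_sub, sub_eq_zero] at h
  have prod_monomial : ∀ κ : Fin l → ℕ,
      ∏ j : Fin l, PowerSeries.monomial ((j : ℕ) + 1) (U.coeff (j + 1)) ^ κ j =
        PowerSeries.monomial (∑ j : Fin l, ((j : ℕ) + 1) * κ j)
          (∏ j : Fin l, U.coeff (j + 1) ^ κ j) := fun κ => by
    simp only [PowerSeries.monomial_eq_C_mul_X_pow, mul_pow, ← pow_mul, prod_mul_distrib,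
      prod_pow_eq_pow_sum, map_prod, map_pow]
  rw [coeff_pow, sum_pow_eq_sum_piAntidiag, map_sum, sum_filter]
  refine sum_congr rfl fun κ _ => ?_
  rw [prod_monomial, ← nsmul_eq_mul, map_nsmul, PowerSeries.coeff_monomial, nsmul_eq_mul]
  simp only [eq_comm (a := l), mul_ite, mul_zero]

theorem filter_faaIndex_sum_eq (l k : ℕ) :
    {κ ∈ faaIndex l | ∑ j, κ j = k} =
      {κ ∈ piAntidiag (univ : Finset (Fin l)) k | ∑ j : Fin l, ((j : ℕ) + 1) * κ j = l} := by
  ext κ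
  simp only [faaIndex, mem_filter, Fintype.mem_piFinset, mem_range, mem_piAntidiag, mem_univ,
    implies_true, and_true, Nat.lt_succ_iff]
  refine ⟨fun ⟨⟨_, hl⟩, hk⟩ => ⟨hk, hl⟩, fun ⟨hk, hl⟩ => ⟨⟨fun j => ?_, hl⟩, hk⟩⟩
  calc κ j ≤ ((j : ℕ) + 1) * κ j := Nat.le_mul_of_pos_left _ j.val.succ_pos
    _ ≤ ∑ i : Fin l, ((i : ℕ) + 1) * κ i :=
      single_le_sum (f := fun i : Fin l => ((i : ℕ) + 1) * κ i) (fun _ _ => Nat.zero_le _)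
        (mem_univ j)
    _ = l := hl

theorem sum_le_of_mem_faaIndex {l : ℕ} {κ : Fin l → ℕ} (hκ : κ ∈ faaIndex l) : ∑ j, κ j ≤ l :=
  calc ∑ j, κ j ≤ ∑ j : Fin l, ((j : ℕ) + 1) * κ j :=
        sum_le_sum fun j _ => Nat.le_mul_of_pos_left _ j.val.succ_pos
    _ = l := (mem_filter.mp hκ).2

theorem faaCoeff_eq_multinomial (l : ℕ) (κ : Fin l → ℕ) :
    faaCoeff l κ = l.factorial / (∑ j, κ j).factorial *
      (Nat.multinomial univ κ / ∏ j : Fin l, (((j : ℕ) + 1).factorial : ℝ) ^ κ j) := by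
  have multinomial_mul : (∏ j, ((κ j).factorial : ℝ)) * Nat.multinomial univ κ =
      (∑ j, κ j).factorial := mod_cast Nat.multinomial_spec univ κ
  have multinomial_ne : (Nat.multinomial univ κ : ℝ) ≠ 0 :=
    mod_cast (Nat.multinomial_pos univ κ).ne'
  rw [faaCoeff, prod_mul_distrib, ← multinomial_mul]
  field_simp

variable [CharZero 𝕜]

theorem coeff_taylorSeries_mul {f g : 𝕜 → 𝕜} {x : 𝕜} {n : ℕ} (hf : ContDiffAt 𝕜 n f x)
    (hg : ContDiffAt 𝕜 n g x) :
    (taylorSeries (fun y => f y * g y) x).coeff n =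
      (taylorSeries f x * taylorSeries g x).coeff n := by
  rw [PowerSeries.coeff_mul, coeff_taylorSeries, iteratedDeriv_fun_mul hf hg,
    Nat.sum_antidiagonal_eq_sum_range_succ
      (fun i j => (taylorSeries f x).coeff i * (taylorSeries g x).coeff j), sum_div]
  refine sum_congr rfl fun i hi => ?_
  have n_factorial_ne : (n.factorial : 𝕜) ≠ 0 := mod_cast n.factorial_ne_zero
  rw [coeff_taylorSeries, coeff_taylorSeries, Nat.cast_choose 𝕜 (mem_range_succ_iff.mp hi)]
  field_simp

theorem coeff_taylorSeries_pow {f : 𝕜 → 𝕜} {x : 𝕜} (k : ℕ) {n : ℕ} (hf : ContDiffAt 𝕜 n f x) :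
    (taylorSeries (fun y => f y ^ k) x).coeff n = (taylorSeries f x ^ k).coeff n := by
  induction k generalizing n with
  | zero =>
    simp only [pow_zero, coeff_taylorSeries, iteratedDeriv_const, PowerSeries.coeff_one]
    split_ifs with h <;> simp [h]
  | succ k ih =>
    simp only [pow_succ]
    rw [coeff_taylorSeries_mul (hf.pow k) hf, PowerSeries.coeff_mul, PowerSeries.coeff_mul]
    refine sum_congr rfl fun p hp => ?_
    rw [ih (hf.of_le (mod_cast Finset.HasAntidiagonal.antidiagonal.fst_le hp))]

theorem iteratedDeriv_sum_mul_sub_pow (a : ℕ → 𝕜) (x : 𝕜) {n i : ℕ} (hi : i ≤ n) :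
    iteratedDeriv i (fun y => ∑ k ∈ range (n + 1), a k / k.factorial * (y - x) ^ k) x = a i := by
  have monomial_at : ∀ k, iteratedDeriv i (fun y => (y - x) ^ k) x =
      if i = k then (k.factorial : 𝕜) else 0 := fun k => by
    rw [iteratedDeriv_comp_sub_const i (· ^ k) x]
    simpa using iteratedDeriv_fun_pow_zero (𝕜 := 𝕜) (n := i) (m := k)
  rw [iteratedDeriv_fun_sum fun k _ => by fun_prop]
  simp only [iteratedDeriv_const_mul_field, monomial_at, mul_ite, mul_zero]
  rw [sum_ite_eq, if_pos (mem_range_succ_iff.mpr hi),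
    div_mul_cancel₀ _ (mod_cast i.factorial_ne_zero)]

theorem iteratedDeriv_comp_eq_sum_coeff_pow {g f : 𝕜 → 𝕜} {x : 𝕜} {l : ℕ}
    (hg : ContDiffAt 𝕜 l g (f x)) (hf : ContDiffAt 𝕜 l f x) :
    iteratedDeriv l (g ∘ f) x = ∑ k ∈ range (l + 1), iteratedDeriv k g (f x) / k.factorial *
      (l.factorial * (taylorSeries (fun y => f y - f x) x ^ k).coeff l) := by
  have hf' : ContDiffAt 𝕜 l (fun y => f y - f x) x := hf.sub contDiffAt_const
  -- The derivative depends on `g` only through its Taylor polynomial `T` at `f x`.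
  let T : 𝕜 → 𝕜 := fun z => ∑ k ∈ range (l + 1), iteratedDeriv k g (f x) / k.factorial *
    (z - f x) ^ k
  calc iteratedDeriv l (g ∘ f) x = iteratedDeriv l (T ∘ f) x :=
        iteratedDeriv_comp_congr hg (by fun_prop) hf fun i hi =>
          (iteratedDeriv_sum_mul_sub_pow (fun k => iteratedDeriv k g (f x)) (f x) hi).symm
    _ = ∑ k ∈ range (l + 1), iteratedDeriv k g (f x) / k.factorial *
          iteratedDeriv l (fun y => (f y - f x) ^ k) x := by
        simp only [T, Function.comp_def]
        rw [iteratedDeriv_fun_sum fun k _ => contDiffAt_const.mul (hf'.pow k)]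
        simp only [iteratedDeriv_const_mul_field]
    _ = _ := by
        refine sum_congr rfl fun k _ => ?_
        rw [← coeff_taylorSeries_pow k hf', coeff_taylorSeries,
          mul_div_cancel₀ _ (mod_cast l.factorial_ne_zero)]

theorem iteratedDeriv_comp_eq_sum_faaIndex {g f : ℝ → ℝ} {x : ℝ} {l : ℕ}
    (hg : ContDiffAt ℝ l g (f x)) (hf : ContDiffAt ℝ l f x) :
    iteratedDeriv l (g ∘ f) x =
      ∑ κ ∈ faaIndex l, faaCoeff l κ * iteratedDeriv (∑ j, κ j) g (f x) *
        ∏ j : Fin l, iteratedDeriv ((j : ℕ) + 1) f x ^ κ j := by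
  have coeff_zero : (taylorSeries (fun y => f y - f x) x).coeff 0 = 0 := by
    rw [coeff_zero_taylorSeries, sub_self]
  have coeff_succ : ∀ j : ℕ, (taylorSeries (fun y => f y - f x) x).coeff (j + 1) =
      iteratedDeriv (j + 1) f x / (j + 1).factorial := fun j => by
    rw [coeff_taylorSeries, iteratedDeriv_succ', iteratedDeriv_succ']
    simp only [deriv_sub_const_fun]
  rw [iteratedDeriv_comp_eq_sum_coeff_pow hg hf, ← sum_fiberwise_of_maps_to fun κ hκ =>
    mem_range_succ_iff.mpr (sum_le_of_mem_faaIndex hκ)]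
  refine sum_congr rfl fun k _ => ?_
  rw [coeff_pow_eq_sum_piAntidiag coeff_zero, ← filter_faaIndex_sum_eq, mul_sum, mul_sum]
  refine sum_congr rfl fun κ hκ => ?_
  rw [← (mem_filter.mp hκ).2, faaCoeff_eq_multinomial]
  simp only [coeff_succ, div_pow, prod_div_distrib]
  ring

end FaaDiBruno

/-! ### Series of monomials -/

theorem hasSum_choose_mul_pow {R : Type*} [CommSemiring R] [TopologicalSpace R] (x y : R) (n : ℕ) :
    HasSum (fun j : ℕ => n.choose j * x ^ (n - j) * y ^ j) ((x + y) ^ n) := by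
  have binomial : (x + y) ^ n = ∑ j ∈ range (n + 1), n.choose j * x ^ (n - j) * y ^ j := by
    rw [add_comm, add_pow]
    exact sum_congr rfl fun j _ => by ring
  rw [binomial]
  refine hasSum_sum_of_ne_finset_zero fun j hj => ?_
  rw [Nat.choose_eq_zero_of_lt (by simpa using hj)]
  simp

section MonomialSeries

variable {ι 𝕜 : Type*} [NontriviallyNormedField 𝕜] {b : ι → 𝕜} {o : ι → ℕ} {x : 𝕜} {r : ℝ}

theorem summable_prod_norm_mul_choose (hr : 0 ≤ r)
    (hs : Summable fun i => ‖b i‖ * (‖x‖ + r) ^ o i) :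
    Summable fun p : ι × ℕ => ‖b p.1‖ * ((o p.1).choose p.2 * ‖x‖ ^ (o p.1 - p.2) * r ^ p.2) := by
  have sum_rows : ∀ i, HasSum (fun j => ‖b i‖ * ((o i).choose j * ‖x‖ ^ (o i - j) * r ^ j))
      (‖b i‖ * (‖x‖ + r) ^ o i) := fun i => (hasSum_choose_mul_pow ‖x‖ r (o i)).mul_left _
  rw [summable_prod_of_nonneg fun p => by positivity]
  exact ⟨fun i => (sum_rows i).summable, hs.congr fun i => (sum_rows i).tsum_eq.symm⟩

theorem norm_mul_choose_mul_pow_le (n j : ℕ) (c y : 𝕜) :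
    ‖c * (n.choose j * x ^ (n - j) * y ^ j)‖ ≤ ‖c‖ * (n.choose j * ‖x‖ ^ (n - j) * ‖y‖ ^ j) := by
  simp only [norm_mul, norm_pow]
  gcongr
  simpa using Nat.norm_cast_le (α := 𝕜) (n.choose j)

variable [CompleteSpace 𝕜]

theorem summable_mul_choose_mul_pow (hr : 0 < r)
    (hs : Summable fun i => ‖b i‖ * (‖x‖ + r) ^ o i) (j : ℕ) :
    Summable fun i => b i * ((o i).choose j * x ^ (o i - j)) := by
  have column := ((summable_prod_norm_mul_choose hr.le hs).comp_injective
    (Prod.mk_left_injective j)).mul_right (r ^ j)⁻¹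
  refine Summable.of_norm_bounded column fun i => ?_
  have hrj : r ^ j ≠ 0 := by positivity
  simpa [mul_assoc, hrj] using norm_mul_choose_mul_pow_le (x := x) (o i) j (b i) 1

theorem hasFPowerSeriesAt_tsum_mul_pow (hr : 0 < r)
    (hs : Summable fun i => ‖b i‖ * (‖x‖ + r) ^ o i) :
    HasFPowerSeriesAt (fun y => ∑' i, b i * y ^ o i)
      (FormalMultilinearSeries.ofScalars 𝕜
        fun j => ∑' i, b i * ((o i).choose j * x ^ (o i - j))) x := by
  rw [hasFPowerSeriesAt_iff]
  filter_upwards [Metric.ball_mem_nhds (0 : 𝕜) hr] with y hy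
  have y_lt : ‖y‖ < r := mem_ball_zero_iff.mp hy
  have summable_prod : Summable fun p : ι × ℕ =>
      b p.1 * ((o p.1).choose p.2 * x ^ (o p.1 - p.2) * y ^ p.2) := by
    refine Summable.of_norm_bounded (summable_prod_norm_mul_choose hr.le hs) fun p => ?_
    exact (norm_mul_choose_mul_pow_le _ _ _ _).trans (by gcongr)
  have sum_rows := summable_prod.hasSum.prod_fiberwise fun i =>
    (hasSum_choose_mul_pow x y (o i)).mul_left (b i)
  have sum_columns := summable_prod.prod_symm.hasSum.prod_fiberwise fun j =>
    (summable_prod.prod_symm.prod_factor j).hasSum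
  rw [sum_rows.tsum_eq, ← (Equiv.prodComm ℕ ι).tsum_eq]
  refine sum_columns.congr_fun fun j => ?_
  rw [FormalMultilinearSeries.coeff_ofScalars, smul_eq_mul, mul_comm, ← tsum_mul_right]
  exact tsum_congr fun i => by simp [mul_assoc]

theorem contDiffAt_tsum_mul_pow (hr : 0 < r) (hs : Summable fun i => ‖b i‖ * (‖x‖ + r) ^ o i)
    {n : WithTop ℕ∞} : ContDiffAt 𝕜 n (fun y => ∑' i, b i * y ^ o i) x :=
  (hasFPowerSeriesAt_tsum_mul_pow hr hs).analyticAt.contDiffAt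

theorem hasSum_iteratedDeriv_tsum_mul_pow (hr : 0 < r)
    (hs : Summable fun i => ‖b i‖ * (‖x‖ + r) ^ o i) (j : ℕ) :
    HasSum (fun i => j.factorial * (b i * ((o i).choose j * x ^ (o i - j))))
      (iteratedDeriv j (fun y => ∑' i, b i * y ^ o i) x) := by
  obtain ⟨ρ, hρ⟩ := hasFPowerSeriesAt_tsum_mul_pow hr hs
  rw [iteratedDeriv_eq_iteratedFDeriv, ← hρ.factorial_smul 1 j,
    FormalMultilinearSeries.ofScalars_apply_eq]
  simpa using (summable_mul_choose_mul_pow hr hs j).hasSum.mul_left (j.factorial : 𝕜)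

end MonomialSeries

/-! ### Smooth parametric integrals -/

section ParametricIntegral

variable {𝕜 E : Type*} [NontriviallyNormedField 𝕜] [NormedAddCommGroup E] [NormedSpace 𝕜 E]

theorem differentiableAt_iteratedDeriv_of_contDiffAt {f : 𝕜 → E} {x : 𝕜} {n : ℕ}
    (hf : ContDiffAt 𝕜 (n + 1) f x) : DifferentiableAt 𝕜 (iteratedDeriv n f) x := by
  have h := (contDiffWithinAt_univ.mpr hf).differentiableWithinAt_iteratedDerivWithin (m := n)
    (mod_cast n.lt_succ_self) (by simp)
  rwa [iteratedDerivWithin_univ, differentiableWithinAt_univ] at h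

variable {Ω : Type*} [MeasurableSpace Ω] {μ : Measure Ω}

theorem aestronglyMeasurable_deriv_of_ae_differentiableAt {F : 𝕜 → Ω → E} {x : 𝕜}
    (hF : ∀ᶠ y in nhds x, AEStronglyMeasurable (F y) μ)
    (hd : ∀ᵐ w ∂μ, DifferentiableAt 𝕜 (F · w) x) :
    AEStronglyMeasurable (fun w => deriv (F · w) x) μ := by
  obtain ⟨y, y_tendsto, hy⟩ := Filter.exists_seq_forall_of_frequently
    (hF.filter_mono nhdsWithin_le_nhds : ∀ᶠ y in nhdsWithin x {x}ᶜ, _).frequently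
  refine aestronglyMeasurable_of_tendsto_ae Filter.atTop (f := fun k w => slope (F · w) x (y k))
    (fun k => ((hy k).sub hF.self_of_nhds).const_smul _) ?_
  filter_upwards [hd] with w hw
  exact hw.hasDerivAt.tendsto_slope.comp y_tendsto

variable {F : 𝕜 → Ω → E} {U : Set 𝕜}

theorem aestronglyMeasurable_iteratedDeriv (hU : IsOpen U)
    (hF : ∀ x ∈ U, AEStronglyMeasurable (F x) μ)
    (hd : ∀ᵐ w ∂μ, ∀ x ∈ U, ContDiffAt 𝕜 ∞ (F · w) x) (n : ℕ) :
    ∀ x ∈ U, AEStronglyMeasurable (fun w => iteratedDeriv n (F · w) x) μ := by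
  induction n with
  | zero => simpa using hF
  | succ n ih =>
    intro x hx
    simp only [iteratedDeriv_succ]
    refine aestronglyMeasurable_deriv_of_ae_differentiableAt
      (F := fun y w => iteratedDeriv n (F · w) y) ?_ ?_
    · filter_upwards [hU.mem_nhds hx] with y hy using ih y hy
    · filter_upwards [hd] with w hw
      exact differentiableAt_iteratedDeriv_of_contDiffAt ((hw x hx).of_le (mod_cast le_top))

/-- A family of functions of a parameter in `𝕜`, smooth on the open set `U` for almost every `w`,
all of whose derivatives are dominated, uniformly on `U`, by integrable functions: the hypothesis
for differentiating `x ↦ ∫ w, F x w ∂μ` arbitrarily often under the integral sign. -/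
structure IsSmoothlyDominated (F : 𝕜 → Ω → E) (U : Set 𝕜) (μ : Measure Ω) : Prop where
  isOpen : IsOpen U
  aestronglyMeasurable : ∀ x ∈ U, AEStronglyMeasurable (F x) μ
  contDiffAt : ∀ᵐ w ∂μ, ∀ x ∈ U, ContDiffAt 𝕜 ∞ (F · w) x
  exists_bound : ∀ n : ℕ, ∃ g : Ω → ℝ, Integrable g μ ∧
    ∀ᵐ w ∂μ, ∀ x ∈ U, ‖iteratedDeriv n (F · w) x‖ ≤ g w

theorem IsSmoothlyDominated.integrable_iteratedDeriv (h : IsSmoothlyDominated F U μ) (n : ℕ)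
    {x : 𝕜} (hx : x ∈ U) : Integrable (fun w => iteratedDeriv n (F · w) x) μ := by
  obtain ⟨g, g_integrable, le_g⟩ := h.exists_bound n
  exact g_integrable.mono'
    (aestronglyMeasurable_iteratedDeriv h.isOpen h.aestronglyMeasurable h.contDiffAt n x hx)
    (le_g.mono fun w hw => hw x hx)

end ParametricIntegral

namespace IsSmoothlyDominated

variable {𝕜 E Ω : Type*} [RCLike 𝕜] [NormedAddCommGroup E] [NormedSpace ℝ E] [NormedSpace 𝕜 E]
  [MeasurableSpace Ω] {μ : Measure Ω} {F : 𝕜 → Ω → E} {U : Set 𝕜}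

theorem hasDerivAt_integral_iteratedDeriv (h : IsSmoothlyDominated F U μ) (n : ℕ) {x : 𝕜}
    (hx : x ∈ U) :
    HasDerivAt (fun y => ∫ w, iteratedDeriv n (F · w) y ∂μ)
      (∫ w, iteratedDeriv (n + 1) (F · w) x ∂μ) x := by
  obtain ⟨g, g_integrable, le_g⟩ := h.exists_bound (n + 1)
  have U_mem := h.isOpen.mem_nhds hx
  have measurable :=
    aestronglyMeasurable_iteratedDeriv h.isOpen h.aestronglyMeasurable h.contDiffAt
  refine (hasDerivAt_integral_of_dominated_loc_of_deriv_le U_mem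
    (F := fun y w => iteratedDeriv n (F · w) y) (F' := fun y w => iteratedDeriv (n + 1) (F · w) y)
    (Filter.eventually_of_mem U_mem (measurable n)) (h.integrable_iteratedDeriv n hx)
    (measurable (n + 1) x hx) le_g g_integrable ?_).2
  filter_upwards [h.contDiffAt] with w hw y hy
  rw [iteratedDeriv_succ]
  exact (differentiableAt_iteratedDeriv_of_contDiffAt
    ((hw y hy).of_le (mod_cast le_top))).hasDerivAt

theorem iteratedDeriv_integral (h : IsSmoothlyDominated F U μ) (n : ℕ) :
    ∀ x ∈ U, iteratedDeriv n (fun y => ∫ w, F y w ∂μ) x = ∫ w, iteratedDeriv n (F · w) x ∂μ := by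
  induction n with
  | zero => simp
  | succ n ih =>
    intro x hx
    rw [iteratedDeriv_succ]
    exact ((h.hasDerivAt_integral_iteratedDeriv n hx).congr_of_eventuallyEq
      (Filter.eventually_of_mem (h.isOpen.mem_nhds hx) ih)).deriv

theorem contDiffOn_integral (h : IsSmoothlyDominated F U μ) :
    ContDiffOn 𝕜 ∞ (fun y => ∫ w, F y w ∂μ) U := by
  refine contDiffOn_of_differentiableOn_deriv fun n _ => ?_
  have integral_eq : Set.EqOn (iteratedDerivWithin n (fun y => ∫ w, F y w ∂μ) U)
      (fun y => ∫ w, iteratedDeriv n (F · w) y ∂μ) U := fun y hy => by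
    rw [iteratedDerivWithin_of_isOpen h.isOpen hy, h.iteratedDeriv_integral n y hy]
  exact DifferentiableOn.congr (fun x hx => (h.hasDerivAt_integral_iteratedDeriv n
    hx).differentiableAt.differentiableWithinAt) integral_eq

end IsSmoothlyDominated

/-! ### The Bernoulli measure -/

/-- The one-sided shift, which forgets the first letter. -/
def shift {α : Type*} (w : ℕ → α) : ℕ → α := fun n => w (n + 1)

section Shift

variable {α : Type*} [MeasurableSpace α]

theorem measurable_shift : Measurable (shift (α := α)) :=
  measurable_pi_lambda _ fun n => measurable_pi_apply (n + 1)

variable (p : Measure α) [IsProbabilityMeasure p]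

theorem indepFun_head_shift : ProbabilityTheory.IndepFun (fun w : ℕ → α => w 0) shift
    (Measure.infinitePi fun _ : ℕ => p) := by
  have indep : ProbabilityTheory.iIndepFun (fun (n : ℕ) (w : ℕ → α) => w n)
      (Measure.infinitePi fun _ : ℕ => p) :=
    ProbabilityTheory.iIndepFun_infinitePi (X := fun _ a => a) fun _ => measurable_id
  refine ProbabilityTheory.IndepFun.indepFun_process (measurable_pi_apply 0)
    (fun n => measurable_pi_apply (n + 1)) fun I => ?_
  have disjoint : Disjoint ({0} : Finset ℕ) (I.map (addRightEmbedding 1)) := by simp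
  have eval_zero : Measurable fun u : ({0} : Finset ℕ) → α => u ⟨0, mem_singleton_self 0⟩ :=
    measurable_pi_apply _
  have restrict : Measurable fun (u : I.map (addRightEmbedding 1) → α) (n : I) =>
      u ⟨n + 1, mem_map_of_mem (addRightEmbedding 1) n.2⟩ := by fun_prop
  exact (indep.indepFun_finset _ _ disjoint fun n => measurable_pi_apply n).comp eval_zero restrict

theorem measurePreserving_head_shift :
    MeasurePreserving (fun w : ℕ → α => (w 0, shift w)) (Measure.infinitePi fun _ : ℕ => p)
      (p.prod (Measure.infinitePi fun _ : ℕ => p)) where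
  measurable := (measurable_pi_apply 0).prodMk measurable_shift
  map_eq := by
    rw [(ProbabilityTheory.indepFun_iff_map_prod_eq_prod_map_map
      (measurable_pi_apply 0).aemeasurable measurable_shift.aemeasurable).mp
      (indepFun_head_shift p), Measure.infinitePi_map_eval]
    congr 1
    exact Measure.map_infinitePi_infinitePi_of_inj (add_left_injective 1)

end Shift

/-- The law `(1/2, 1/2)` of a single letter, so that `wordMeasure` is its infinite power. -/
def letterMeasure : Measure (Fin 2) := (PMF.uniformOfFintype (Fin 2)).toMeasure

instance : IsProbabilityMeasure letterMeasure :=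
  inferInstanceAs (IsProbabilityMeasure (PMF.uniformOfFintype (Fin 2)).toMeasure)

instance : IsProbabilityMeasure wordMeasure :=
  inferInstanceAs (IsProbabilityMeasure (Measure.infinitePi _))

theorem letterMeasure_eq_sum_dirac :
    letterMeasure = ∑ i : Fin 2, (2⁻¹ : ℝ≥0∞) • Measure.dirac i := by
  refine Measure.ext_of_singleton fun i => ?_
  rw [letterMeasure, PMF.toMeasure_apply_singleton _ _ (measurableSet_singleton i)]
  fin_cases i <;> simp

theorem measurePreserving_head_tail :
    MeasurePreserving (fun w : Words => (w 0, shift w)) wordMeasure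
      (letterMeasure.prod wordMeasure) :=
  measurePreserving_head_shift letterMeasure

theorem integral_letterMeasure (c : Fin 2 → ℝ) : ∫ i, c i ∂letterMeasure = (c 0 + c 1) / 2 := by
  rw [integral_fintype .of_finite, Fin.sum_univ_two, letterMeasure_eq_sum_dirac]
  simp [Measure.real]
  ring

/-! ### Products of contraction ratios -/

theorem exists_integrable_forall_norm_le {Ω E ι : Type*} [MeasurableSpace Ω]
    [NormedAddCommGroup E] [Countable ι] {μ : Measure Ω} {f : ι → Ω → E}
    (hf : ∀ i, Integrable (f i) μ) (hsum : Summable fun i => ∫ w, ‖f i w‖ ∂μ) :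
    ∃ g : Ω → ℝ, Integrable g μ ∧ ∀ᵐ w ∂μ, ∀ i, ‖f i w‖ ≤ g w := by
  have measurable : AEMeasurable (fun w => ∑' i, ‖f i w‖ₑ) μ :=
    AEMeasurable.tsum fun i => (hf i).aestronglyMeasurable.enorm
  have finite : ∫⁻ w, ∑' i, ‖f i w‖ₑ ∂μ ≠ ⊤ := by
    rw [lintegral_tsum fun i => (hf i).aestronglyMeasurable.enorm]
    simp_rw [← ofReal_integral_norm_eq_lintegral_enorm (hf _)]
    exact hsum.tsum_ofReal_ne_top
  refine ⟨fun w => (∑' i, ‖f i w‖ₑ).toReal,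
    integrable_toReal_of_lintegral_ne_top measurable finite, ?_⟩
  filter_upwards [ae_lt_top' measurable finite] with w hw i
  simpa using ENNReal.toReal_mono hw.ne (ENNReal.le_tsum i)

section WordRatio

variable {lam lam' : Fin 2 → ℝ} {w : Words}

@[fun_prop]
theorem measurable_wordRatio (lam : Fin 2 → ℝ) (m : ℕ) : Measurable fun w => wordRatio lam w m :=
  Finset.measurable_prod _ fun k _ => (measurable_of_finite lam).comp (measurable_pi_apply k)

@[simp]
theorem wordRatio_zero (lam : Fin 2 → ℝ) (w : Words) : wordRatio lam w 0 = 1 :=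
  prod_range_zero _

theorem wordRatio_succ (lam : Fin 2 → ℝ) (w : Words) (m : ℕ) :
    wordRatio lam w (m + 1) = wordRatio lam w m * lam (w m) :=
  prod_range_succ _ m

theorem wordRatio_succ_eq_mul_shift (lam : Fin 2 → ℝ) (w : Words) (m : ℕ) :
    wordRatio lam w (m + 1) = lam (w 0) * wordRatio lam (shift w) m :=
  prod_range_succ' _ m |>.trans (mul_comm _ _)

theorem wordRatio_rpow (hlam : ∀ i, 0 ≤ lam i) (w : Words) (m : ℕ) (s : ℝ) :
    wordRatio lam w m ^ s = wordRatio (fun i => lam i ^ s) w m :=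
  (Real.finsetProd_rpow _ _ (fun _ _ => hlam _) s).symm

theorem wordRatio_pos (hlam : ∀ i, 0 < lam i) (w : Words) (m : ℕ) : 0 < wordRatio lam w m :=
  prod_pos fun _ _ => hlam _

theorem wordRatio_le_wordRatio (hlam : ∀ i, 0 ≤ lam i) (h : lam ≤ lam') (w : Words) (m : ℕ) :
    wordRatio lam w m ≤ wordRatio lam' w m :=
  prod_le_prod (fun _ _ => hlam _) fun _ _ => h _

theorem integral_wordRatio (lam : Fin 2 → ℝ) (m : ℕ) :
    ∫ w, wordRatio lam w m ∂wordMeasure = ((lam 0 + lam 1) / 2) ^ m := by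
  induction m with
  | zero => simp
  | succ m ih =>
    simp_rw [wordRatio_succ_eq_mul_shift]
    rw [← integral_map (φ := fun w : Words => (w 0, shift w))
        (f := fun z => lam z.1 * wordRatio lam z.2 m)
        measurePreserving_head_tail.aemeasurable, measurePreserving_head_tail.map_eq,
      integral_prod_mul lam fun w => wordRatio lam w m, ih, integral_letterMeasure, pow_succ']
    exact (((measurable_of_finite lam).comp measurable_fst).mul
      ((measurable_wordRatio lam m).comp measurable_snd)).aestronglyMeasurable

theorem integrable_wordRatio (lam : Fin 2 → ℝ) (m : ℕ) :
    Integrable (fun w => wordRatio lam w m) wordMeasure := by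
  refine .of_bound (measurable_wordRatio lam m).aestronglyMeasurable ((∑ i, |lam i|) ^ m)
    (.of_forall fun w => ?_)
  calc ‖wordRatio lam w m‖ = ∏ k ∈ range m, |lam (w k)| := norm_prod _ _
    _ ≤ ∏ k ∈ range m, ∑ i, |lam i| := prod_le_prod (fun _ _ => abs_nonneg _) fun k _ =>
      single_le_sum (f := fun i => |lam i|) (fun _ _ => abs_nonneg _) (mem_univ _)
    _ = (∑ i, |lam i|) ^ m := by simp

theorem norm_wordRatio_mul_le (hlam : ∀ i, 0 ≤ lam i) (d : Fin 2 → ℝ) (w : Words) (m : ℕ) :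
    ‖wordRatio lam w m * d (w m)‖ ≤ wordRatio lam w m * ∑ i, |d i| := by
  have nonneg : 0 ≤ wordRatio lam w m := prod_nonneg fun _ _ => hlam _
  rw [norm_mul, Real.norm_of_nonneg nonneg]
  gcongr
  exact single_le_sum (f := fun i => |d i|) (fun _ _ => abs_nonneg _) (mem_univ _)

theorem summable_wordRatio_mul (hlam : ∀ i, 0 ≤ lam i) (hw : Summable (wordRatio lam w))
    (d : Fin 2 → ℝ) : Summable fun m => wordRatio lam w m * d (w m) :=
  .of_norm_bounded (hw.mul_right _) (norm_wordRatio_mul_le hlam d w)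

end WordRatio

/-- The logarithm of the contraction ratio of a random letter has negative mean: the system
`x ↦ lam i * x + d i` with probabilities `1/2` contracts on average. -/
structure ContractsOnAverage (lam : Fin 2 → ℝ) : Prop where
  pos : ∀ i, 0 < lam i
  mul_lt_one : lam 0 * lam 1 < 1

namespace ContractsOnAverage

variable {lam : Fin 2 → ℝ}

theorem exists_mean_rpow_lt_one (h : ContractsOnAverage lam) :
    ∃ s ∈ Set.Ioc (0 : ℝ) 1, (lam 0 ^ s + lam 1 ^ s) / 2 < 1 := by
  -- `s ↦ (lam 0 ^ s + lam 1 ^ s) / 2` takes the value `1` at `0` with negative slope.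
  have hasDerivAt : HasDerivAt (fun s : ℝ => lam 0 ^ s + lam 1 ^ s) (Real.log (lam 0 * lam 1)) 0 :=
    by simpa [Real.log_mul (h.pos 0).ne' (h.pos 1).ne', Pi.add_def] using
      (Real.hasStrictDerivAt_const_rpow (h.pos 0) 0).hasDerivAt.add
        (Real.hasStrictDerivAt_const_rpow (h.pos 1) 0).hasDerivAt
  have slope_neg := (hasDerivAt.tendsto_slope.mono_left
    (nhdsGT_le_nhdsNE 0)).eventually_lt_const
      (Real.log_neg (mul_pos (h.pos 0) (h.pos 1)) h.mul_lt_one)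
  obtain ⟨s, hs, s_mem⟩ := (slope_neg.and (Ioc_mem_nhdsGT (zero_lt_one' ℝ))).exists
  refine ⟨s, s_mem, ?_⟩
  rw [slope_def_field, sub_zero, div_lt_iff₀ s_mem.1, zero_mul, Real.rpow_zero,
    Real.rpow_zero] at hs
  linarith

theorem exists_integrable_geometric_bound (h : ContractsOnAverage lam) :
    ∃ s ∈ Set.Ioc (0 : ℝ) 1, ∃ q ∈ Set.Ioo (0 : ℝ) 1, ∃ V : Words → ℝ, Integrable V wordMeasure ∧
      ∀ᵐ w ∂wordMeasure, ∀ m, wordRatio lam w m ^ s ≤ V w * q ^ m := by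
  obtain ⟨s, s_mem, hs⟩ := h.exists_mean_rpow_lt_one
  have rpow_pos : ∀ i, 0 < lam i ^ s := fun i => Real.rpow_pos_of_pos (h.pos i) s
  have mean_pos : 0 < (lam 0 ^ s + lam 1 ^ s) / 2 := half_pos (add_pos (rpow_pos 0) (rpow_pos 1))
  obtain ⟨q, mean_lt_q, q_lt_one⟩ := exists_between hs
  have q_pos : 0 < q := mean_pos.trans mean_lt_q
  have norm_eq : ∀ m w, ‖wordRatio (fun i => lam i ^ s) w m / q ^ m‖ =
      wordRatio (fun i => lam i ^ s) w m / q ^ m := fun m w =>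
    Real.norm_of_nonneg (div_nonneg (wordRatio_pos rpow_pos w m).le (pow_pos q_pos m).le)
  obtain ⟨V, V_integrable, hV⟩ := exists_integrable_forall_norm_le
    (f := fun m w => wordRatio (fun i => lam i ^ s) w m / q ^ m) (μ := wordMeasure)
    (fun m => (integrable_wordRatio _ m).div_const _) <| by
      simp_rw [norm_eq, integral_div, integral_wordRatio, ← div_pow]
      exact summable_geometric_of_lt_one (by positivity) ((div_lt_one q_pos).mpr mean_lt_q)
  refine ⟨s, s_mem, q, ⟨q_pos, q_lt_one⟩, V, V_integrable, ?_⟩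
  filter_upwards [hV] with w hw m
  rw [wordRatio_rpow (fun i => (h.pos i).le), ← div_le_iff₀ (pow_pos q_pos m), ← norm_eq]
  exact hw m

theorem ae_summable_wordRatio (h : ContractsOnAverage lam) :
    ∀ᵐ w ∂wordMeasure, Summable (wordRatio lam w) := by
  obtain ⟨s, ⟨s_pos, -⟩, q, ⟨q_pos, q_lt_one⟩, V, -, hV⟩ := h.exists_integrable_geometric_bound
  filter_upwards [hV] with w hw
  have V_nonneg : 0 ≤ V w := zero_le_one.trans (by simpa using hw 0)
  have root_lt_one : q ^ s⁻¹ < 1 := Real.rpow_lt_one q_pos.le q_lt_one (inv_pos.mpr s_pos)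
  refine .of_nonneg_of_le (fun m => (wordRatio_pos h.pos w m).le) (fun m => ?_)
    ((summable_geometric_of_lt_one (by positivity) root_lt_one).mul_left (V w ^ s⁻¹))
  rw [Real.rpow_pow_comm q_pos.le, ← Real.mul_rpow V_nonneg (by positivity)]
  exact (Real.le_rpow_inv_iff_of_pos (wordRatio_pos h.pos w m).le (by positivity) s_pos).mpr (hw m)

end ContractsOnAverage

/-! ### The stationary measure -/

/-- One step of the random iteration: the map of the system with index `z.1` at the point `z.2`. -/
def randomMap (lam d : Fin 2 → ℝ) (z : Fin 2 × ℝ) : ℝ := lam z.1 * z.2 + d z.1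

/-- The composition of the maps of the system along the first `n` letters of `w`, the first letter
being applied last; as a function of `n` this is the backward random iteration. -/
def wordMap (lam d : Fin 2 → ℝ) (n : ℕ) (w : Words) (x : ℝ) : ℝ :=
  ∑ m ∈ range n, wordRatio lam w m * d (w m) + wordRatio lam w n * x

section StationaryMeasure

variable {lam d : Fin 2 → ℝ} {w : Words} {μ : Measure ℝ}

theorem measurable_randomMap (lam d : Fin 2 → ℝ) : Measurable (randomMap lam d) :=
  (((measurable_of_finite lam).comp measurable_fst).mul measurable_snd).add
    ((measurable_of_finite d).comp measurable_fst)

theorem measurable_proj (lam d : Fin 2 → ℝ) : Measurable (proj lam d) :=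
  .tsum fun m => (measurable_wordRatio lam m).mul
    ((measurable_of_finite d).comp (measurable_pi_apply m))

theorem map_randomMap (lam d : Fin 2 → ℝ) (μ : Measure ℝ) [SFinite μ] :
    (letterMeasure.prod μ).map (randomMap lam d) =
      ∑ i : Fin 2, (2⁻¹ : ℝ≥0∞) • μ.map fun x => lam i * x + d i := by
  have map_dirac : ∀ i, ((Measure.dirac i).prod μ).map (randomMap lam d) =
      μ.map fun x => lam i * x + d i := fun i => by
    rw [Measure.dirac_prod, Measure.map_map (measurable_randomMap lam d) measurable_prodMk_left]
    rfl
  simp only [letterMeasure_eq_sum_dirac, Fin.sum_univ_two, Measure.add_prod,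
    Measure.prod_smul_left, Measure.map_add _ _ (measurable_randomMap lam d), Measure.map_smul,
    map_dirac]

theorem isStationary_iff_measurePreserving [IsProbabilityMeasure μ] :
    IsStationary lam d μ ↔ MeasurePreserving (randomMap lam d) (letterMeasure.prod μ) μ := by
  rw [IsStationary, ← map_randomMap, eq_comm]
  exact ⟨fun h => ⟨measurable_randomMap lam d, h.2⟩, fun h => ⟨inferInstance, h.map_eq⟩⟩

theorem wordMap_succ (lam d : Fin 2 → ℝ) (n : ℕ) (w : Words) (x : ℝ) :
    wordMap lam d (n + 1) w x = randomMap lam d (w 0, wordMap lam d n (shift w) x) := by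
  simp only [wordMap, randomMap, sum_range_succ', wordRatio_succ_eq_mul_shift, wordRatio_zero,
    shift, mul_add, mul_sum, mul_assoc]
  ring

theorem IsStationary.measurePreserving_wordMap (h : IsStationary lam d μ) (n : ℕ) :
    MeasurePreserving (fun z : Words × ℝ => wordMap lam d n z.1 z.2) (wordMeasure.prod μ) μ := by
  have := h.1
  induction n with
  | zero => simpa [wordMap] using measurePreserving_snd (μ := wordMeasure) (ν := μ)
  | succ n ih =>
    simp_rw [wordMap_succ]
    exact (isStationary_iff_measurePreserving.mp h).comp <|
      ((MeasurePreserving.id letterMeasure).prod ih).comp <|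
      (measurePreserving_prodAssoc letterMeasure wordMeasure μ).comp <|
      measurePreserving_head_tail.prod (MeasurePreserving.id μ)

theorem tendsto_wordMap (hlam : ∀ i, 0 ≤ lam i) (hw : Summable (wordRatio lam w))
    (d : Fin 2 → ℝ) (x : ℝ) :
    Filter.Tendsto (fun n => wordMap lam d n w x) .atTop (nhds (proj lam d w)) := by
  simpa [wordMap, proj] using (summable_wordRatio_mul hlam hw d).hasSum.tendsto_sum_nat.add
    (hw.tendsto_atTop_zero.mul_const x)

theorem proj_eq_randomMap_shift (hlam : ∀ i, 0 < lam i) (hw : Summable (wordRatio lam w))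
    (d : Fin 2 → ℝ) : proj lam d w = randomMap lam d (w 0, proj lam d (shift w)) := by
  have head_ne_zero := (hlam (w 0)).ne'
  have summable_shift : Summable (wordRatio lam (shift w)) := by
    rwa [← summable_nat_add_iff 1, funext (wordRatio_succ_eq_mul_shift lam w ·),
      summable_mul_left_iff head_ne_zero] at hw
  refine tendsto_nhds_unique ((tendsto_wordMap (hlam · |>.le) hw d 0).comp
    (Filter.tendsto_add_atTop_nat 1)) ?_
  simp only [Function.comp_def, wordMap_succ]
  exact ((tendsto_wordMap (hlam · |>.le) summable_shift d 0).const_mul _).add_const _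

namespace ContractsOnAverage

theorem isStationary_map_proj (h : ContractsOnAverage lam) (d : Fin 2 → ℝ) :
    IsStationary lam d (wordMeasure.map (proj lam d)) := by
  have measurable := measurable_proj lam d
  have := Measure.isProbabilityMeasure_map (μ := wordMeasure) measurable.aemeasurable
  have law : MeasurePreserving (proj lam d) wordMeasure (wordMeasure.map (proj lam d)) :=
    ⟨measurable, rfl⟩
  rw [isStationary_iff_measurePreserving]
  refine ⟨measurable_randomMap lam d, ?_⟩
  have law_tail := ((MeasurePreserving.id letterMeasure).prod law).comp measurePreserving_head_tail
  rw [← law_tail.map_eq, Measure.map_map (measurable_randomMap lam d) law_tail.measurable]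
  refine Measure.map_congr ?_
  filter_upwards [h.ae_summable_wordRatio] with w hw
  exact (proj_eq_randomMap_shift h.pos hw d).symm

theorem eq_map_proj (h : ContractsOnAverage lam) (hμ : IsStationary lam d μ) :
    μ = wordMeasure.map (proj lam d) := by
  have := hμ.1
  have preserving := hμ.measurePreserving_wordMap
  have tendsto_proj : TendstoInDistribution
      (fun n (z : Words × ℝ) => wordMap lam d n z.1 z.2) .atTop (proj lam d ∘ Prod.fst)
      (fun _ => wordMeasure.prod μ) (wordMeasure.prod μ) := by
    refine tendstoInDistribution_of_ae_tendsto (fun n => (preserving n).aemeasurable)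
      ((measurable_proj lam d).comp measurable_fst).aemeasurable ?_
    filter_upwards [Measure.quasiMeasurePreserving_fst.ae h.ae_summable_wordRatio] with z hz
    exact tendsto_wordMap (h.pos · |>.le) hz d z.2
  have tendsto_stationary : TendstoInDistribution
      (fun n (z : Words × ℝ) => wordMap lam d n z.1 z.2) .atTop id
      (fun _ => wordMeasure.prod μ) μ :=
    tendstoInDistribution_of_identDistrib 0
      (fun n => ⟨(preserving 0).aemeasurable, (preserving n).aemeasurable,
        (preserving 0).map_eq.trans (preserving n).map_eq.symm⟩)
      ⟨(preserving 0).aemeasurable, aemeasurable_id,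
        (preserving 0).map_eq.trans Measure.map_id.symm⟩
  have map_eq := tendstoInDistribution_unique _ tendsto_stationary tendsto_proj
  rw [Measure.map_id] at map_eq
  rw [map_eq, ← Measure.map_map (measurable_proj lam d) measurable_fst,
    measurePreserving_fst.map_eq]

theorem existsUnique_isStationary (h : ContractsOnAverage lam) (d : Fin 2 → ℝ) :
    ∃! μ, IsStationary lam d μ :=
  ⟨_, h.isStationary_map_proj d, fun _ hμ => h.eq_map_proj hμ⟩

theorem stationaryMeasure_eq_map_proj (h : ContractsOnAverage lam) (d : Fin 2 → ℝ) :
    stationaryMeasure lam d = wordMeasure.map (proj lam d) := by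
  have exists_isStationary := (h.existsUnique_isStationary d).exists
  rw [stationaryMeasure, dif_pos exists_isStationary]
  exact h.eq_map_proj exists_isStationary.choose_spec

end ContractsOnAverage

end StationaryMeasure

/-! ### The random variables `X(ε)` and their derivatives -/

section XDerivatives

variable {lam₁ lam₂ ε : ℝ} {d : Fin 2 → ℝ} {w : Words}

theorem contractsOnAverage_ratio_iff :
    ContractsOnAverage (ratio lam₁ lam₂ ε) ↔
      (0 < lam₁ + ε ∧ 0 < lam₂) ∧ (lam₁ + ε) * lam₂ < 1 := by
  constructor
  · rintro ⟨pos, mul_lt_one⟩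
    exact ⟨Fin.forall_fin_two.mp pos, mul_lt_one⟩
  · rintro ⟨pos, mul_lt_one⟩
    exact ⟨Fin.forall_fin_two.mpr pos, mul_lt_one⟩

theorem ratio_mono (lam₁ lam₂ : ℝ) : Monotone (ratio lam₁ lam₂) := fun _ _ h =>
  Fin.forall_fin_two.mpr ⟨add_le_add_right h lam₁, le_rfl⟩

theorem ContractsOnAverage.eventually_ratio (h : ContractsOnAverage (ratio lam₁ lam₂ ε)) :
    ∀ᶠ ε' in nhds ε, ContractsOnAverage (ratio lam₁ lam₂ ε') := by
  simp only [contractsOnAverage_ratio_iff] at h ⊢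
  have tendsto : Filter.Tendsto (fun ε' => lam₁ + ε') (nhds ε) (nhds (lam₁ + ε)) :=
    tendsto_const_nhds.add Filter.tendsto_id
  exact ((tendsto.eventually_const_lt h.1.1).and (.of_forall fun _ => h.1.2)).and
    ((tendsto.mul_const lam₂).eventually_lt_const h.2)

theorem ContractsOnAverage.exists_ratio_gt (h : ContractsOnAverage (ratio lam₁ lam₂ ε)) :
    ∃ q : ℚ, ε < q ∧ ContractsOnAverage (ratio lam₁ lam₂ q) := by
  obtain ⟨u, ε_lt_u, hu⟩ := exists_Ico_subset_of_mem_nhds h.eventually_ratio (exists_gt ε)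
  obtain ⟨q, ε_lt_q, q_lt_u⟩ := exists_rat_btwn ε_lt_u
  exact ⟨q, ε_lt_q, hu ⟨ε_lt_q.le, q_lt_u⟩⟩

theorem onesCount_le (w : Words) (m : ℕ) : onesCount w m ≤ m :=
  (card_filter_le _ _).trans_eq (card_range m)

theorem wordRatio_ratio (lam₁ lam₂ ε : ℝ) (w : Words) (m : ℕ) :
    wordRatio (ratio lam₁ lam₂ ε) w m =
      lam₂ ^ (m - onesCount w m) * (lam₁ + ε) ^ onesCount w m := by
  have ratio_eq : ∀ i, ratio lam₁ lam₂ ε i = if i = 0 then lam₁ + ε else lam₂ :=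
    Fin.forall_fin_two.mpr ⟨rfl, rfl⟩
  have card_not : #{k ∈ range m | ¬ w k = 0} = m - onesCount w m := by
    rw [filter_not, card_sdiff_of_subset (filter_subset _ _), card_range, onesCount]
  simp only [wordRatio, ratio_eq, prod_ite, prod_const, card_not, onesCount, mul_comm]

/-- The words along which the products of ratios are summable for every parameter `ε` for which the
perturbed system contracts on average; the exceptional set does not depend on `ε`. -/
def IsRegularWord (lam₁ lam₂ : ℝ) (w : Words) : Prop :=
  ∀ ε, ContractsOnAverage (ratio lam₁ lam₂ ε) → Summable (wordRatio (ratio lam₁ lam₂ ε) w)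

theorem ae_isRegularWord (lam₁ lam₂ : ℝ) : ∀ᵐ w ∂wordMeasure, IsRegularWord lam₁ lam₂ w := by
  -- The products increase with `ε`, so that rational parameters suffice.
  have ae_rat : ∀ᵐ w ∂wordMeasure, ∀ q : ℚ, ContractsOnAverage (ratio lam₁ lam₂ q) →
      Summable (wordRatio (ratio lam₁ lam₂ q) w) :=
    ae_all_iff.mpr fun _ =>
      Filter.eventually_imp_distrib_left.mpr fun hq => hq.ae_summable_wordRatio
  filter_upwards [ae_rat] with w hw ε h
  obtain ⟨q, ε_lt_q, hq⟩ := h.exists_ratio_gt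
  exact .of_nonneg_of_le (fun m => (wordRatio_pos h.pos w m).le)
    (wordRatio_le_wordRatio (h.pos · |>.le) (ratio_mono _ _ ε_lt_q.le) w) (hw q hq)

theorem X_eq_tsum (lam₁ lam₂ : ℝ) (d : Fin 2 → ℝ) (w : Words) (ε : ℝ) :
    X lam₁ lam₂ d ε w =
      ∑' m, lam₂ ^ (m - onesCount w m) * d (w m) * (lam₁ + ε) ^ onesCount w m :=
  tsum_congr fun m => by rw [wordRatio_ratio, mul_right_comm]

theorem IsRegularWord.exists_summable_norm_mul_pow (hw : IsRegularWord lam₁ lam₂ w)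
    (h : ContractsOnAverage (ratio lam₁ lam₂ ε)) (d : Fin 2 → ℝ) : ∃ r > 0, Summable fun m =>
    ‖lam₂ ^ (m - onesCount w m) * d (w m)‖ * (‖lam₁ + ε‖ + r) ^ onesCount w m := by
  obtain ⟨q, ε_lt_q, hq⟩ := h.exists_ratio_gt
  have pos := contractsOnAverage_ratio_iff.mp h
  refine ⟨q - ε, sub_pos.mpr ε_lt_q, (summable_wordRatio_mul (hq.pos · |>.le) (hw q hq)
    fun i => ‖d i‖).congr fun m => ?_⟩
  rw [wordRatio_ratio, norm_mul, norm_pow, Real.norm_of_nonneg pos.1.1.le,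
    Real.norm_of_nonneg pos.1.2.le]
  ring

theorem IsRegularWord.contDiffAt_X (hw : IsRegularWord lam₁ lam₂ w)
    (h : ContractsOnAverage (ratio lam₁ lam₂ ε)) (d : Fin 2 → ℝ) :
    ContDiffAt ℝ ∞ (fun ε => X lam₁ lam₂ d ε w) ε := by
  obtain ⟨r, r_pos, summable⟩ := hw.exists_summable_norm_mul_pow h d
  simp only [X_eq_tsum]
  exact (contDiffAt_tsum_mul_pow r_pos summable).comp ε (by fun_prop : ContDiffAt ℝ ∞ (lam₁ + ·) ε)

theorem IsRegularWord.hasSum_iteratedDeriv_X (hw : IsRegularWord lam₁ lam₂ w)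
    (h : ContractsOnAverage (ratio lam₁ lam₂ ε)) (d : Fin 2 → ℝ) (j : ℕ) :
    HasSum (fun m => (j.factorial : ℝ) / (lam₁ + ε) ^ j *
        (wordRatio (ratio lam₁ lam₂ ε) w m * ((onesCount w m).choose j : ℝ) * d (w m)))
      (iteratedDeriv j (fun ε => X lam₁ lam₂ d ε w) ε) := by
  obtain ⟨r, r_pos, summable⟩ := hw.exists_summable_norm_mul_pow h d
  have ne_zero : lam₁ + ε ≠ 0 := (h.pos 0).ne'
  simp only [X_eq_tsum]
  rw [iteratedDeriv_comp_const_add j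
    (fun y => ∑' m, lam₂ ^ (m - onesCount w m) * d (w m) * y ^ onesCount w m)]
  refine (hasSum_iteratedDeriv_tsum_mul_pow r_pos summable j).congr_fun fun m => ?_
  rw [wordRatio_ratio]
  rcases le_or_gt j (onesCount w m) with hj | hj
  · rw [← pow_sub_mul_pow (lam₁ + ε) hj]
    field_simp
  · simp [Nat.choose_eq_zero_of_lt hj]

theorem IsRegularWord.norm_iteratedDeriv_X_le (hw : IsRegularWord lam₁ lam₂ w)
    (h : ContractsOnAverage (ratio lam₁ lam₂ ε)) {B q : ℝ} (hq : q ∈ Set.Ioo 0 1)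
    (hB : ∀ m, wordRatio (ratio lam₁ lam₂ ε) w m ≤ B * q ^ m) (d : Fin 2 → ℝ) (j : ℕ) :
    ‖iteratedDeriv j (fun ε => X lam₁ lam₂ d ε w) ε‖ ≤
      j.factorial / (lam₁ + ε) ^ j * ((∑ i, |d i|) * ∑' m : ℕ, (m : ℝ) ^ j * q ^ m) * B := by
  have head_pos : 0 < lam₁ + ε := h.pos 0
  have summable : Summable fun m : ℕ => (m : ℝ) ^ j * q ^ m :=
    summable_pow_mul_geometric_of_norm_lt_one j ((Real.norm_of_nonneg hq.1.le).trans_lt hq.2)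
  rw [← (hw.hasSum_iteratedDeriv_X h d j).tsum_eq]
  refine tsum_of_norm_bounded (((summable.hasSum.mul_left _).mul_left _).mul_right B) fun m => ?_
  have choose_le : ((onesCount w m).choose j : ℝ) ≤ (m : ℝ) ^ j := mod_cast
    (Nat.choose_le_pow _ _).trans (Nat.pow_le_pow_left (onesCount_le w m) j)
  calc _ = j.factorial / (lam₁ + ε) ^ j *
        (‖wordRatio (ratio lam₁ lam₂ ε) w m * d (w m)‖ * (onesCount w m).choose j) := by
        rw [mul_right_comm, norm_mul, norm_mul, Real.norm_of_nonneg (by positivity),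
          Real.norm_natCast]
    _ ≤ j.factorial / (lam₁ + ε) ^ j * (B * q ^ m * (∑ i, |d i|) * m ^ j) := by
        have bound : ‖wordRatio (ratio lam₁ lam₂ ε) w m * d (w m)‖ ≤ B * q ^ m * ∑ i, |d i| :=
          (norm_wordRatio_mul_le (h.pos · |>.le) d w m).trans (by gcongr; exact hB m)
        have bound_nonneg := (norm_nonneg _).trans bound
        gcongr
    _ = _ := by ring

end XDerivatives

/-! ### Points of the attractor in a bounded set -/

section Attractor

variable {lam d : Fin 2 → ℝ} {w : Words}

theorem hasSum_wordRatio_mul_sub_randomMap (hlam : ∀ i, 0 ≤ lam i)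
    (hw : Summable (wordRatio lam w)) (d : Fin 2 → ℝ) (p : ℝ) :
    HasSum (fun m => wordRatio lam w m * (p - randomMap lam d (w m, p))) (p - proj lam d w) := by
  have partialSum : ∀ n, ∑ m ∈ range n, wordRatio lam w m * (p - randomMap lam d (w m, p)) =
      p - wordMap lam d n w p := fun n => by
    induction n with
    | zero => simp [wordMap]
    | succ n ih =>
      rw [sum_range_succ, ih]
      simp only [wordMap, randomMap, sum_range_succ, wordRatio_succ]
      ring
  refine ((summable_wordRatio_mul hlam hw fun i =>
    p - randomMap lam d (i, p)).hasSum_iff_tendsto_nat).mpr ?_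
  simp only [partialSum]
  exact (tendsto_wordMap hlam hw d p).const_sub p

theorem exists_wordRatio_le_of_eq_zero (hlam : ∀ i, 0 < lam i) (one_le : 1 ≤ lam 1)
    (hw : Summable (wordRatio lam w)) (m : ℕ) :
    ∃ k, w k = 0 ∧ wordRatio lam w m ≤ wordRatio lam w k := by
  by_contra! lt
  have le : ∀ k ≥ m, wordRatio lam w m ≤ wordRatio lam w k := fun k hk => by
    induction k, hk using Nat.le_induction with
    | base => exact le_rfl
    | succ k _ ih =>
      have letter : w k = 1 := Fin.eq_one_of_ne_zero _ fun h => (lt k h).not_ge ih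
      rw [wordRatio_succ, letter]
      exact ih.trans (le_mul_of_one_le_right (wordRatio_pos hlam w k).le one_le)
  exact (wordRatio_pos hlam w m).not_ge <|
    ge_of_tendsto hw.tendsto_atTop_zero (Filter.eventually_atTop.mpr ⟨m, le⟩)

theorem wordRatio_mul_abs_sub_randomMap_le (hlam : ∀ i, 0 < lam i) (one_le : 1 ≤ lam 1)
    (hw : Summable (wordRatio lam w)) {p : ℝ} (hp : randomMap lam d (1, p) = p) (m : ℕ) :
    wordRatio lam w m * |p - randomMap lam d (0, p)| ≤ |p - proj lam d w| := by
  -- Expanded at the fixed point `p` of the expanding map, `p - proj lam d w` is a series whose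
  -- terms all have the same sign.
  set c := p - randomMap lam d (0, p) with c_def
  rcases eq_or_ne c 0 with c_zero | c_ne_zero
  · simp [c_zero]
  have term_nonneg : ∀ k, 0 ≤ wordRatio lam w k * (p - randomMap lam d (w k, p)) * c := fun k => by
    rw [mul_assoc]
    refine mul_nonneg (wordRatio_pos hlam w k).le ?_
    generalize w k = i
    fin_cases i
    · exact mul_self_nonneg c
    · simp [hp]
  obtain ⟨k, letter, le⟩ := exists_wordRatio_le_of_eq_zero hlam one_le hw m
  have term_le := le_hasSum ((hasSum_wordRatio_mul_sub_randomMap (hlam · |>.le) hw d p).mul_right c)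
    k fun k' _ => term_nonneg k'
  rw [letter, ← c_def] at term_le
  refine le_of_mul_le_mul_right ?_ (abs_pos.mpr c_ne_zero)
  calc wordRatio lam w m * |c| * |c| = wordRatio lam w m * (c * c) := by
        rw [mul_assoc, abs_mul_abs_self]
    _ ≤ wordRatio lam w k * (c * c) := by gcongr; exact mul_self_nonneg c
    _ ≤ (p - proj lam d w) * c := by rwa [← mul_assoc]
    _ ≤ |p - proj lam d w| * |c| := by rw [← abs_mul]; exact le_abs_self _

end Attractor

section Support

variable {lam₁ lam₂ : ℝ} {d : Fin 2 → ℝ}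

theorem exists_forall_wordRatio_le_of_X_mem (h : ContractsOnAverage (ratio lam₁ lam₂ 0))
    (h_gt : 1 < lam₂) (h_fix : ¬ ∃ x : ℝ, lam₁ * x + d 0 = x ∧ lam₂ * x + d 1 = x)
    {K : Set ℝ} (hK : Bornology.IsBounded K) :
    ∃ R ≥ 1, ∀ᶠ ε in nhds 0, ∀ w, Summable (wordRatio (ratio lam₁ lam₂ ε) w) →
      X lam₁ lam₂ d ε w ∈ K → ∀ m, wordRatio (ratio lam₁ lam₂ ε) w m ≤ R := by
  obtain ⟨p, hp⟩ : ∃ p, lam₂ * p + d 1 = p :=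
    ⟨d 1 / (1 - lam₂), by field_simp [(sub_neg.mpr h_gt).ne]; ring⟩
  let c : ℝ → ℝ := fun ε => |p - ((lam₁ + ε) * p + d 0)|
  have c_pos : 0 < c 0 := abs_pos.mpr fun hc => h_fix ⟨p, by linarith, hp⟩
  have c_gt : ∀ᶠ ε in nhds 0, c 0 / 2 < c ε :=
    (by fun_prop : Continuous c).continuousAt.eventually_const_lt (half_lt_self c_pos)
  obtain ⟨D, hD⟩ := hK.exists_norm_le
  refine ⟨max 1 ((|p| + D) / (c 0 / 2)), le_max_left _ _, ?_⟩
  filter_upwards [c_gt, h.eventually_ratio] with ε hε contracts w hw mem m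
  refine le_max_of_le_right ((le_div_iff₀ (half_pos c_pos)).mpr ?_)
  have wordRatio_nonneg := (wordRatio_pos contracts.pos w m).le
  calc wordRatio (ratio lam₁ lam₂ ε) w m * (c 0 / 2)
      ≤ wordRatio (ratio lam₁ lam₂ ε) w m * c ε := by gcongr
    _ ≤ |p - X lam₁ lam₂ d ε w| :=
      wordRatio_mul_abs_sub_randomMap_le contracts.pos h_gt.le hw hp m
    _ ≤ |p| + D := (abs_sub _ _).trans (by gcongr; exact hD _ mem)

theorem le_mul_rpow_of_rpow_le {P R Q s t : ℝ} (P_pos : 0 < P) (P_le : P ≤ R) (one_le : 1 ≤ R)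
    (rpow_le : P ^ s ≤ Q) (hs : 0 ≤ s) (ht : 0 ≤ t) (hst : s * t ≤ 1) : P ≤ R * Q ^ t := by
  have := P_pos.trans_le P_le
  calc P = P ^ (1 - s * t) * (P ^ s) ^ t := by
        rw [← Real.rpow_mul P_pos.le, ← Real.rpow_add P_pos, sub_add_cancel, Real.rpow_one]
    _ ≤ R ^ (1 - s * t) * Q ^ t := by gcongr
    _ ≤ R * Q ^ t := by
      gcongr
      · exact Real.rpow_nonneg ((Real.rpow_nonneg P_pos.le s).trans rpow_le) t
      · exact (Real.rpow_le_rpow_of_exponent_le one_le (sub_le_self 1 (mul_nonneg hs ht))).trans_eq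
          (Real.rpow_one R)

end Support

/-! ### Domination of the derivatives of `φ(X(ε))` -/

section Composition

variable {𝕜 E : Type*} [NontriviallyNormedField 𝕜] [NormedAddCommGroup E] [NormedSpace 𝕜 E]
  {g : 𝕜 → E} {f : 𝕜 → 𝕜} {x : 𝕜} {n : ℕ}

theorem norm_iteratedDeriv_comp_le (hg : ContDiff 𝕜 n g) (hf : ContDiffAt 𝕜 n f x) {C D : ℝ}
    (hC : ∀ i ≤ n, ‖iteratedDeriv i g (f x)‖ ≤ C)
    (hD : ∀ i, 1 ≤ i → i ≤ n → ‖iteratedDeriv i f x‖ ≤ D ^ i) :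
    ‖iteratedDeriv n (g ∘ f) x‖ ≤ n.factorial * C * D ^ n := by
  obtain ⟨s, hs, s_open, mem⟩ := mem_nhds_iff.mp (hf.eventually (by simp))
  rw [← norm_iteratedFDeriv_eq_norm_iteratedDeriv, ← iteratedFDerivWithin_of_isOpen n s_open mem]
  refine norm_iteratedFDerivWithin_comp_le hg.contDiffOn
    (fun y hy => ContDiffAt.contDiffWithinAt (hs hy)) le_rfl uniqueDiffOn_univ
    s_open.uniqueDiffOn (Set.mapsTo_univ f s) mem (fun i hi => ?_) fun i hi hi' => ?_
  · rw [iteratedFDerivWithin_univ, norm_iteratedFDeriv_eq_norm_iteratedDeriv]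
    exact hC i hi
  · rw [iteratedFDerivWithin_of_isOpen i s_open mem, norm_iteratedFDeriv_eq_norm_iteratedDeriv]
    exact hD i hi hi'

theorem iteratedDeriv_comp_of_notMem_tsupport (hf : ContinuousAt f x) (hx : f x ∉ tsupport g)
    (n : ℕ) : iteratedDeriv n (g ∘ f) x = 0 := by
  have comp_eq : g ∘ f =ᶠ[nhds x] fun _ => 0 :=
    hf.eventually (notMem_tsupport_iff_eventuallyEq.mp hx)
  rw [comp_eq.iteratedDeriv_eq, iteratedDeriv_fun_const_zero]

theorem exists_forall_norm_iteratedDeriv_le_of_hasCompactSupport (hg : ContDiff 𝕜 n g)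
    (hgc : HasCompactSupport g) : ∃ C, ∀ i ≤ n, ∀ y, ‖iteratedDeriv i g y‖ ≤ C := by
  have compactSupport : ∀ i, HasCompactSupport (iteratedDeriv i g) := fun i => by
    induction i with
    | zero => simpa using hgc
    | succ i ih => exact iteratedDeriv_succ (f := g) ▸ ih.deriv
  choose! C hC using fun i (hi : i ≤ n) => (compactSupport i).exists_bound_of_continuous
    (hg.continuous_iteratedDeriv i (mod_cast hi))
  refine ⟨∑ i ∈ range (n + 1), C i, fun i hi y => (hC i hi y).trans <|
    single_le_sum (fun k hk => (norm_nonneg _).trans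
      (hC k (mem_range_succ_iff.mp hk) y)) (mem_range_succ_iff.mpr hi)⟩

end Composition

section Domination

variable {lam₁ lam₂ : ℝ} {φ : ℝ → ℝ}

theorem exists_forall_norm_iteratedDeriv_X_le {a q : ℝ} (ha : 0 < a) (hq : q ∈ Set.Ioo 0 1)
    (lam₁ lam₂ : ℝ) (d : Fin 2 → ℝ) (n : ℕ) :
    ∃ M ≥ 1, ∀ ε w B, ContractsOnAverage (ratio lam₁ lam₂ ε) → IsRegularWord lam₁ lam₂ w →
      a ≤ lam₁ + ε → (∀ m, wordRatio (ratio lam₁ lam₂ ε) w m ≤ B * q ^ m) →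
      ∀ j ≤ n, ‖iteratedDeriv j (fun ε => X lam₁ lam₂ d ε w) ε‖ ≤ M * B := by
  let c : ℕ → ℝ := fun j =>
    j.factorial / a ^ j * ((∑ i, |d i|) * ∑' m : ℕ, (m : ℝ) ^ j * q ^ m)
  have q_nonneg : 0 ≤ q := hq.1.le
  have c_nonneg : ∀ j, 0 ≤ c j := fun j => by positivity
  refine ⟨1 + ∑ j ∈ range (n + 1), c j, le_add_of_nonneg_right (sum_nonneg fun j _ => c_nonneg j),
    fun ε w B h hw a_le hB j hj => ?_⟩
  have B_nonneg : 0 ≤ B := zero_le_one.trans (by simpa using hB 0)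
  calc _ ≤ j.factorial / (lam₁ + ε) ^ j *
        ((∑ i, |d i|) * ∑' m : ℕ, (m : ℝ) ^ j * q ^ m) * B :=
        hw.norm_iteratedDeriv_X_le h hq hB d j
    _ ≤ c j * B := by unfold c; gcongr
    _ ≤ (1 + ∑ j ∈ range (n + 1), c j) * B := by
        gcongr
        exact (single_le_sum (fun j _ => c_nonneg j) (mem_range_succ_iff.mpr hj)).trans
          (le_add_of_nonneg_left zero_le_one)

theorem exists_forall_norm_iteratedDeriv_comp_X_le (hφ : ContDiff ℝ ∞ φ)
    (hφc : HasCompactSupport φ) {a q : ℝ} (ha : 0 < a) (hq : q ∈ Set.Ioo 0 1)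
    (lam₁ lam₂ : ℝ) (d : Fin 2 → ℝ) (n : ℕ) :
    ∃ C ≥ 0, ∀ ε w B, ContractsOnAverage (ratio lam₁ lam₂ ε) → IsRegularWord lam₁ lam₂ w →
      a ≤ lam₁ + ε → (∀ m, wordRatio (ratio lam₁ lam₂ ε) w m ≤ B * q ^ m) →
      ‖iteratedDeriv n (fun ε => φ (X lam₁ lam₂ d ε w)) ε‖ ≤ C * B ^ n := by
  have φ_contDiff : ContDiff ℝ n φ := hφ.of_le (mod_cast le_top)
  obtain ⟨C, hC⟩ := exists_forall_norm_iteratedDeriv_le_of_hasCompactSupport φ_contDiff hφc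
  obtain ⟨M, one_le_M, hM⟩ := exists_forall_norm_iteratedDeriv_X_le ha hq lam₁ lam₂ d n
  have C_nonneg : 0 ≤ C := (norm_nonneg _).trans (hC 0 n.zero_le 0)
  refine ⟨n.factorial * C * M ^ n, by positivity, fun ε w B h hw a_le hB => ?_⟩
  have one_le_B : 1 ≤ B := by simpa using hB 0
  rw [mul_assoc, ← mul_pow]
  exact norm_iteratedDeriv_comp_le φ_contDiff ((hw.contDiffAt_X h d).of_le (mod_cast le_top))
    (fun i hi => hC i hi _) fun i hi hi' => (hM ε w B h hw a_le hB i hi').trans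
      (le_self_pow₀ (one_le_mul_of_one_le_of_one_le one_le_M one_le_B) (by lia))

theorem exists_forall_norm_iteratedDeriv_comp_X_le_mul (hφ : ContDiff ℝ ∞ φ)
    (hφc : HasCompactSupport φ) {a q R s : ℝ} (ha : 0 < a) (hq : q ∈ Set.Ioo 0 1) (hR : 1 ≤ R)
    (hs : s ∈ Set.Ioc 0 1) (lam₁ lam₂ : ℝ) (d : Fin 2 → ℝ) (n : ℕ) :
    ∃ C, ∀ ε w V, ContractsOnAverage (ratio lam₁ lam₂ ε) → IsRegularWord lam₁ lam₂ w →
      a ≤ lam₁ + ε →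
      (X lam₁ lam₂ d ε w ∈ tsupport φ → ∀ m, wordRatio (ratio lam₁ lam₂ ε) w m ≤ R) →
      (∀ m, wordRatio (ratio lam₁ lam₂ ε) w m ^ s ≤ V * q ^ m) →
      ‖iteratedDeriv n (fun ε => φ (X lam₁ lam₂ d ε w)) ε‖ ≤ C * V := by
  -- Interpolating between `P ≤ R` and `P ^ s ≤ V * q ^ m` with the exponent `t = 1 / (n + 1)`
  -- makes the `n`-th power of the bound for `P` at most linear in `V`.
  let t : ℝ := 1 / (n + 1)
  have t_nonneg : 0 ≤ t := by positivity
  have t_le_one : t ≤ 1 := div_le_one_of_le₀ (by linarith [n.cast_nonneg (α := ℝ)]) (by positivity)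
  have root_mem : q ^ t ∈ Set.Ioo 0 1 :=
    ⟨Real.rpow_pos_of_pos hq.1 t, Real.rpow_lt_one hq.1.le hq.2 (by positivity)⟩
  obtain ⟨C, C_nonneg, hC⟩ :=
    exists_forall_norm_iteratedDeriv_comp_X_le hφ hφc ha root_mem lam₁ lam₂ d n
  refine ⟨C * R ^ n, fun ε w V h hw a_le le_R rpow_le => ?_⟩
  have one_le_V : 1 ≤ V := by simpa using rpow_le 0
  by_cases mem : X lam₁ lam₂ d ε w ∈ tsupport φ
  swap
  · rw [← Function.comp_def φ, iteratedDeriv_comp_of_notMem_tsupport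
      (hw.contDiffAt_X h d).continuousAt mem, norm_zero]
    positivity
  have le_geometric : ∀ m, wordRatio (ratio lam₁ lam₂ ε) w m ≤ R * V ^ t * (q ^ t) ^ m := fun m =>
    calc wordRatio (ratio lam₁ lam₂ ε) w m ≤ R * (V * q ^ m) ^ t :=
          le_mul_rpow_of_rpow_le (wordRatio_pos h.pos w m) (le_R mem m) hR (rpow_le m) hs.1.le
            t_nonneg (mul_le_one₀ hs.2 t_nonneg t_le_one)
      _ = R * V ^ t * (q ^ t) ^ m := by
          rw [Real.mul_rpow (by positivity) (pow_nonneg hq.1.le m), Real.rpow_pow_comm hq.1.le,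
            mul_assoc]
  calc _ ≤ C * (R * V ^ t) ^ n := hC ε w _ h hw a_le le_geometric
    _ = C * R ^ n * V ^ (t * n) := by rw [mul_pow, Real.rpow_mul_natCast (by positivity), mul_assoc]
    _ ≤ C * R ^ n * V := by
        gcongr
        refine Real.rpow_le_self_of_one_le one_le_V ?_
        rw [one_div_mul_eq_div]
        exact div_le_one_of_le₀ (by linarith) (by positivity)

theorem response_eq_integral_X {ε : ℝ} (h : ContractsOnAverage (ratio lam₁ lam₂ ε)) (d : Fin 2 → ℝ)
    (hφ : Continuous φ) :
    response lam₁ lam₂ d φ ε = ∫ w, φ (X lam₁ lam₂ d ε w) ∂wordMeasure := by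
  rw [response, h.stationaryMeasure_eq_map_proj,
    integral_map (measurable_proj _ d).aemeasurable hφ.aestronglyMeasurable]
  rfl

theorem exists_response_eqOn_and_isSmoothlyDominated {d : Fin 2 → ℝ}
    (h : ContractsOnAverage (ratio lam₁ lam₂ 0)) (h_gt : 1 < lam₂)
    (h_fix : ¬ ∃ x : ℝ, lam₁ * x + d 0 = x ∧ lam₂ * x + d 1 = x) (hφ : ContDiff ℝ ∞ φ)
    (hφc : HasCompactSupport φ) :
    ∃ U ∈ nhds 0, Set.EqOn (response lam₁ lam₂ d φ)
        (fun ε => ∫ w, φ (X lam₁ lam₂ d ε w) ∂wordMeasure) U ∧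
      IsSmoothlyDominated (fun ε w => φ (X lam₁ lam₂ d ε w)) U wordMeasure := by
  have lam₁_pos : 0 < lam₁ := by simpa [ratio] using h.pos 0
  obtain ⟨R, one_le_R, le_R⟩ := exists_forall_wordRatio_le_of_X_mem h h_gt h_fix hφc.isBounded
  obtain ⟨ε₁, ε₁_pos, h₁⟩ := h.exists_ratio_gt
  obtain ⟨s, s_mem, q, q_mem, V, V_integrable, hV⟩ := h₁.exists_integrable_geometric_bound
  obtain ⟨U, hU, U_open, zero_mem⟩ := mem_nhds_iff.mp <| h.eventually_ratio.and <|
    le_R.and <| (gt_mem_nhds ε₁_pos).and <| lt_mem_nhds (neg_lt_zero.mpr (half_pos lam₁_pos))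
  refine ⟨U, U_open.mem_nhds zero_mem,
    fun ε hε => response_eq_integral_X (hU hε).1 d hφ.continuous, U_open, fun ε _ => ?_, ?_,
    fun n => ?_⟩
  · exact (hφ.continuous.measurable.comp (measurable_proj _ d)).aestronglyMeasurable
  · filter_upwards [ae_isRegularWord lam₁ lam₂] with w hw ε hε
    exact hφ.contDiffAt.comp ε (hw.contDiffAt_X (hU hε).1 d)
  · obtain ⟨C, hC⟩ := exists_forall_norm_iteratedDeriv_comp_X_le_mul hφ hφc (half_pos lam₁_pos)
      q_mem one_le_R s_mem lam₁ lam₂ d n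
    refine ⟨fun w => C * V w, V_integrable.const_mul C, ?_⟩
    filter_upwards [ae_isRegularWord lam₁ lam₂, hV] with w hw V_bound ε hε
    obtain ⟨contracts, le_R, ε_lt, lt_ε⟩ := hU hε
    refine hC ε w (V w) contracts hw (by linarith) (le_R w (hw ε contracts)) fun m => ?_
    exact (Real.rpow_le_rpow (wordRatio_pos contracts.pos w m).le
      (wordRatio_le_wordRatio (contracts.pos · |>.le) (ratio_mono _ _ ε_lt.le) w m)
      s_mem.1.le).trans (V_bound m)

end Domination

/-! ### The derivatives at `0` -/

section DerivativesAtZero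

variable {lam₁ lam₂ : ℝ} {φ : ℝ → ℝ}

theorem IsRegularWord.hasSum_XDeriv {w : Words} (h : ContractsOnAverage (ratio lam₁ lam₂ 0))
    (hw : IsRegularWord lam₁ lam₂ w) (d : Fin 2 → ℝ) (j : ℕ) :
    HasSum (fun m => (j.factorial : ℝ) / lam₁ ^ j *
        (wordRatio (ratio lam₁ lam₂ 0) w m * ((onesCount w m).choose j : ℝ) * d (w m)))
      (XDeriv lam₁ lam₂ d j w) := by
  simpa only [add_zero, XDeriv] using hw.hasSum_iteratedDeriv_X h d j

theorem IsRegularWord.iteratedDeriv_comp_X {w : Words}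
    (h : ContractsOnAverage (ratio lam₁ lam₂ 0)) (hw : IsRegularWord lam₁ lam₂ w)
    (d : Fin 2 → ℝ) (hφ : ContDiff ℝ ∞ φ) (l : ℕ) :
    iteratedDeriv l (fun ε => φ (X lam₁ lam₂ d ε w)) 0 = formalDeriv lam₁ lam₂ d φ l w :=
  iteratedDeriv_comp_eq_sum_faaIndex (hφ.contDiffAt.of_le (mod_cast le_top))
    ((hw.contDiffAt_X h d).of_le (mod_cast le_top))

end DerivativesAtZero

end

end LinearResponse

theorem mainTheorem1 (lam₁ lam₂ : ℝ) (h_pos : 0 < lam₁) (h_lt : lam₁ < 1) (h_gt : 1 < lam₂)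
    (h_mul : lam₁ * lam₂ < 1) (d : Fin 2 → ℝ)
    (h_fix : ¬ ∃ x : ℝ, lam₁ * x + d 0 = x ∧ lam₂ * x + d 1 = x)
    (φ : ℝ → ℝ) (hφ : ContDiff ℝ ∞ φ) (hφc : HasCompactSupport φ) :
    -- the stationary measures and the random variables `X(ε)`, `X^{(j)}` are well defined
    (∀ ε : ℝ, 0 < lam₁ + ε → (lam₁ + ε) * lam₂ < 1 →
      ∃! μ : Measure ℝ, LinearResponse.IsStationary (LinearResponse.ratio lam₁ lam₂ ε) d μ) ∧
    (∀ᵐ w ∂LinearResponse.wordMeasure,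
      (∀ ε : ℝ, 0 < lam₁ + ε → (lam₁ + ε) * lam₂ < 1 →
        Summable fun m : ℕ =>
          LinearResponse.wordRatio (LinearResponse.ratio lam₁ lam₂ ε) w m * d (w m)) ∧
      ContDiffAt ℝ ∞ (fun ε => LinearResponse.X lam₁ lam₂ d ε w) 0 ∧
      ∀ j : ℕ, 1 ≤ j →
        HasSum (fun m : ℕ => (j.factorial : ℝ) / lam₁ ^ j *
            (LinearResponse.wordRatio (LinearResponse.ratio lam₁ lam₂ 0) w m *
              ((LinearResponse.onesCount w m).choose j : ℝ) * d (w m)))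
          (LinearResponse.XDeriv lam₁ lam₂ d j w)) ∧
    -- infinite differentiability at `0` and the formula for the derivatives
    ContDiffAt ℝ ∞ (LinearResponse.response lam₁ lam₂ d φ) 0 ∧
    ∀ l : ℕ,
      Integrable (fun w => iteratedDeriv l (fun ε => φ (LinearResponse.X lam₁ lam₂ d ε w)) 0)
        LinearResponse.wordMeasure ∧
      iteratedDeriv l (LinearResponse.response lam₁ lam₂ d φ) 0 =
        ∫ w, iteratedDeriv l (fun ε => φ (LinearResponse.X lam₁ lam₂ d ε w)) 0
          ∂LinearResponse.wordMeasure ∧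
      Integrable (LinearResponse.formalDeriv lam₁ lam₂ d φ l) LinearResponse.wordMeasure ∧
      ∫ w, iteratedDeriv l (fun ε => φ (LinearResponse.X lam₁ lam₂ d ε w)) 0
          ∂LinearResponse.wordMeasure =
        ∫ w, LinearResponse.formalDeriv lam₁ lam₂ d φ l w ∂LinearResponse.wordMeasure := by
  have contracts : ∀ ε, 0 < lam₁ + ε → (lam₁ + ε) * lam₂ < 1 →
      LinearResponse.ContractsOnAverage (LinearResponse.ratio lam₁ lam₂ ε) := fun _ h h' =>
    LinearResponse.contractsOnAverage_ratio_iff.mpr ⟨⟨h, one_pos.trans h_gt⟩, h'⟩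
  have h₀ := contracts 0 (by simpa) (by simpa)
  have regular := LinearResponse.ae_isRegularWord lam₁ lam₂
  obtain ⟨U, U_mem, response_eq, dominated⟩ :=
    LinearResponse.exists_response_eqOn_and_isSmoothlyDominated h₀ h_gt h_fix hφ hφc
  have integrable := fun l => dominated.integrable_iteratedDeriv l (mem_of_mem_nhds U_mem)
  have deriv_eq := fun l => regular.mono fun w hw => hw.iteratedDeriv_comp_X h₀ d hφ l
  refine ⟨fun ε h h' => (contracts ε h h').existsUnique_isStationary d, ?_,
    (dominated.contDiffOn_integral.congr response_eq).contDiffAt U_mem,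
    fun l => ⟨integrable l, ?_, (integrable l).congr (deriv_eq l), integral_congr_ae (deriv_eq l)⟩⟩
  · filter_upwards [regular] with w hw
    refine ⟨fun ε h h' => ?_, hw.contDiffAt_X h₀ d, fun j _ => hw.hasSum_XDeriv h₀ d j⟩
    have h_ε := contracts ε h h'
    exact LinearResponse.summable_wordRatio_mul (h_ε.pos · |>.le) (hw ε h_ε) d
  · rw [(response_eq.eventuallyEq_of_mem U_mem).iteratedDeriv_eq,
      dominated.iteratedDeriv_integral l 0 (mem_of_mem_nhds U_mem)]
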